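/- Let $\mathcal{P}_{\rm m}$ be the space of sequences $\mathbf{s}=(s_1,s_2,\ldots)$ with $s_1\ge s_2\ge\cdots\ge 0$ and $\sum_{i\ge1}s_i\le 1$. Let $\nu$ be a nonzero finite measure on $\mathcal{P}_{\rm m}$, of total mass $\lambda=\nu(\mathcal{P}_{\rm m})<\infty$, with $\sum_{i\ge 1}s_i=1$ for $\nu$-almost every $\mathbf{s}$ and $\nu(\{(1,0,0,\ldots)\})=0$ (a conservative dislocation measure of finite activity). Suppose that there are constants $C_0,c>0$ such that $$\nu(\{\mathbf{s}\in\mathcal{P}_{\rm m}: 1-s_1<\delta\})\le C_0\,\delta^{c}\qquad\text{for all }\delta\in[0,1].$$ Then there are constants $\beta\in(0,1)$ and $C>0$, depending only on $\nu$, such that the following holds. Let $(\xi_t)_{t\ge0}$ be any real-valued Lévy process with Laplace exponent $$\Phi(q)=-\log\mathbb{E}\left[e^{-q\xi_1}\right]=\int_{\mathcal{P}_{\rm m}}\Big(1-\sum_{i\ge1}s_i^{q+1}\Big)\,\nu(\mathrm{d}\mathbf{s}),\qquad q\ge0$$ (the spine subordinator associated with $\nu$). Then for all $t\ge0$ and $w\in[0,1]$,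 $$\mathbb{P}(\xi_t\le w)=\exp\left(-\lambda t+e(t,w)\right)\qquad\text{for some real } e(t,w)\text{ with } |e(t,w)|\le C\,t^{\beta}w^{1-\beta}.$$ -/

import Mathlib

open MeasureTheory ProbabilityTheory Filter Topology
open scoped NNReal ENNReal

namespace Fragmentation

/-- The space `𝒫ₘ` of mass partitions: sequences `s₁ ≥ s₂ ≥ ⋯ ≥ 0` with `∑ sᵢ ≤ 1`. Indices start
at `0` here, so `s.1 0` is the largest mass `s₁`. As a subtype of `ℕ → ℝ` it carries the
`σ`-algebra generated by the coordinates. -/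
abbrev MassPartition : Type :=
  {s : ℕ → ℝ // Antitone s ∧ (∀ i, 0 ≤ s i) ∧ Summable s ∧ ∑' i, s i ≤ 1}

/-- A (conservative) dislocation measure: a nonzero measure `ν` on mass partitions which is carried
by `{∑ sᵢ = 1}`, has no mass at `(1, 0, 0, …)`, and satisfies `∫ (1 - s₁) dν < ∞`. -/
structure IsDislocationMeasure (ν : Measure MassPartition) : Prop where
  ne_zero : ν ≠ 0
  conservative : ∀ᵐ s ∂ν, ∑' i, s.1 i = 1
  no_trivial : ν {s | s.1 = Pi.single 0 1} = 0
  lintegral_lt_top : ∫⁻ s, ENNReal.ofReal (1 - s.1 0) ∂ν < ∞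

/-- The regularity assumption on a dislocation measure of finite activity: there are `C, c > 0` with
`ν {1 - s₁ < δ} ≤ C δ ^ c` for all `δ ∈ [0, 1]`. -/
def HasPolynomialErosion (ν : Measure MassPartition) : Prop :=
  ∃ C c : ℝ, 0 < C ∧ 0 < c ∧ ∀ δ : ℝ, 0 ≤ δ → δ ≤ 1 →
    ν {s | 1 - s.1 0 < δ} ≤ ENNReal.ofReal (C * δ ^ c)

/-- The function `Φ(q) = ∫ (1 - ∑ sᵢ ^ (q + 1)) ν(ds)`, for `q ≥ 0`. -/
noncomputable def laplaceExponent (ν : Measure MassPartition) (q : ℝ) : ℝ :=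
  ∫ s, (1 - ∑' i, s.1 i ^ (q + 1)) ∂ν

/-- A real-valued Lévy process: started at `0`, with independent and stationary increments, and
almost surely right-continuous paths with left limits. -/
structure IsLevyProcess {Ω : Type*} [MeasurableSpace Ω] (P : Measure Ω) (ξ : ℝ≥0 → Ω → ℝ) :
    Prop where
  measurable : ∀ t, Measurable (ξ t)
  zero : ∀ᵐ ω ∂P, ξ 0 ω = 0
  indep_increments : HasIndepIncrements ξ P
  stationary_increments : ∀ s t : ℝ≥0, IdentDistrib (fun ω => ξ (s + t) ω - ξ s ω) (ξ t) P P
  cadlag : ∀ᵐ ω ∂P, ∀ t : ℝ≥0, ContinuousWithinAt (fun r => ξ r ω) (Set.Ici t) t ∧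
    ∃ l : ℝ, Tendsto (fun r => ξ r ω) (𝓝[<] t) (𝓝 l)

/-- `ξ` has Laplace exponent `Φ`, that is `𝔼[exp (-q ξ₁)] = exp (-Φ(q))` for all `q ≥ 0`. -/
def HasLaplaceExponent {Ω : Type*} [MeasurableSpace Ω] (P : Measure Ω) (ξ : ℝ≥0 → Ω → ℝ)
    (Φ : ℝ → ℝ) : Prop :=
  ∀ q : ℝ, 0 ≤ q → Integrable (fun ω => Real.exp (-q * ξ 1 ω)) P ∧
    ∫ ω, Real.exp (-q * ξ 1 ω) ∂P = Real.exp (-Φ q)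

end Fragmentation

/-! Write `Φ` for the Laplace exponent, `λ` for the mass of `ν`. Since `0 ≤ Φ ≤ λ`, the process is
a.s. nonnegative at each time, and letting `q → ∞` in `𝔼[exp (-q ξₜ)] = exp (-t Φ(q))` gives `P(ξₜ =
0) ≥ exp (-λt)`; hence `e ≥ 0` (`exp_le_measureReal`).

For the upper bound, Chernoff gives `P(ξₜ ≤ w) ≤ exp (q w - t Φ(q))`. Polynomial erosion yields
`Φ(q) ≥ λ - K q ^ (-γ)` for `q ≥ 1` (`exists_sub_rpow_le_laplaceExponent`), so `e ≤ q w + K t q ^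
(-γ)`. Balancing the two terms in `q` produces `β = 1 / (1 + γ)`. -/

namespace Fragmentation

/-! ### Power sums of a mass partition. -/

namespace MassPartition

lemma le_one (s : MassPartition) (i : ℕ) : s.1 i ≤ 1 :=
  (s.2.2.2.1.le_tsum i fun j _ => s.2.2.1 j).trans s.2.2.2.2

lemma rpow_add_one_le (s : MassPartition) {q : ℝ} (hq : 0 ≤ q) (i : ℕ) :
    s.1 i ^ (q + 1) ≤ s.1 0 ^ q * s.1 i := by
  rw [Real.rpow_add_one' (s.2.2.1 i) (by positivity)]
  exact mul_le_mul_of_nonneg_right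
    (Real.rpow_le_rpow (s.2.2.1 i) (s.2.1 (Nat.zero_le i)) hq) (s.2.2.1 i)

lemma summable_rpow_add_one (s : MassPartition) {q : ℝ} (hq : 0 ≤ q) :
    Summable fun i => s.1 i ^ (q + 1) :=
  Summable.of_nonneg_of_le (fun i => Real.rpow_nonneg (s.2.2.1 i) _)
    (s.rpow_add_one_le hq) (s.2.2.2.1.mul_left _)

lemma tsum_rpow_add_one_nonneg (s : MassPartition) (q : ℝ) : 0 ≤ ∑' i, s.1 i ^ (q + 1) :=
  tsum_nonneg fun i => Real.rpow_nonneg (s.2.2.1 i) _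

lemma tsum_rpow_add_one_le (s : MassPartition) {q : ℝ} (hq : 0 ≤ q) :
    ∑' i, s.1 i ^ (q + 1) ≤ s.1 0 ^ q := by
  calc ∑' i, s.1 i ^ (q + 1) ≤ ∑' i, s.1 0 ^ q * s.1 i :=
        (s.summable_rpow_add_one hq).tsum_le_tsum (s.rpow_add_one_le hq) (s.2.2.2.1.mul_left _)
    _ = s.1 0 ^ q * ∑' i, s.1 i := tsum_mul_left
    _ ≤ s.1 0 ^ q := mul_le_of_le_one_right (Real.rpow_nonneg (s.2.2.1 0) _) s.2.2.2.2

lemma rpow_le_one (s : MassPartition) {q : ℝ} (hq : 0 ≤ q) : s.1 0 ^ q ≤ 1 :=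
  Real.rpow_le_one (s.2.2.1 0) (s.le_one 0) hq

lemma measurable_coord (i : ℕ) : Measurable fun s : MassPartition => s.1 i :=
  (measurable_pi_apply i).comp measurable_subtype_coe

lemma measurable_tsum_rpow_add_one {q : ℝ} (hq : 0 ≤ q) :
    Measurable fun s : MassPartition => ∑' i, s.1 i ^ (q + 1) := by
  refine measurable_of_tendsto_metrizable
    (f := fun n (s : MassPartition) => ∑ i ∈ Finset.range n, s.1 i ^ (q + 1)) (fun n => ?_) ?_
  · exact Finset.measurable_fun_sum _ fun i _ => (measurable_coord i).pow_const _
  · exact tendsto_pi_nhds.2 fun s => (s.summable_rpow_add_one hq).hasSum.tendsto_sum_nat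

end MassPartition

/-! ### Bounds on the Laplace exponent. -/

section LaplaceExponent

variable {ν : Measure MassPartition} {q : ℝ}

lemma laplaceExponent_nonneg (hq : 0 ≤ q) : 0 ≤ laplaceExponent ν q :=
  integral_nonneg fun s => sub_nonneg.2 <|
    (s.tsum_rpow_add_one_le hq).trans (s.rpow_le_one hq)

variable [IsFiniteMeasure ν]

lemma integrable_rpow (hq : 0 ≤ q) : Integrable (fun s : MassPartition => s.1 0 ^ q) ν := by
  refine Integrable.of_bound
    ((MassPartition.measurable_coord 0).pow_const q).aestronglyMeasurable 1 (ae_of_all _ fun s => ?_)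
  rw [Real.norm_of_nonneg (Real.rpow_nonneg (s.2.2.1 0) _)]
  exact s.rpow_le_one hq

lemma integrable_one_sub_tsum_rpow (hq : 0 ≤ q) :
    Integrable (fun s : MassPartition => 1 - ∑' i, s.1 i ^ (q + 1)) ν := by
  refine Integrable.of_bound
    (measurable_const.sub (MassPartition.measurable_tsum_rpow_add_one hq)).aestronglyMeasurable 1
    (ae_of_all _ fun s => ?_)
  have h₁ := s.tsum_rpow_add_one_nonneg q
  have h₂ := (s.tsum_rpow_add_one_le hq).trans (s.rpow_le_one hq)
  rw [Real.norm_of_nonneg (by linarith)]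
  linarith

lemma laplaceExponent_le (hq : 0 ≤ q) : laplaceExponent ν q ≤ ν.real Set.univ := by
  calc laplaceExponent ν q ≤ ∫ _ : MassPartition, (1 : ℝ) ∂ν :=
        integral_mono (integrable_one_sub_tsum_rpow hq) (integrable_const _)
          fun s => sub_le_self _ (s.tsum_rpow_add_one_nonneg q)
    _ = ν.real Set.univ := by simp

lemma sub_integral_rpow_le_laplaceExponent (hq : 0 ≤ q) :
    ν.real Set.univ - ∫ s : MassPartition, s.1 0 ^ q ∂ν ≤ laplaceExponent ν q := by
  calc ν.real Set.univ - ∫ s : MassPartition, s.1 0 ^ q ∂ν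
      = ∫ s : MassPartition, (1 - s.1 0 ^ q) ∂ν := by
        rw [integral_sub (integrable_const _) (integrable_rpow hq)]; simp
    _ ≤ laplaceExponent ν q :=
        integral_mono ((integrable_const _).sub (integrable_rpow hq))
          (integrable_one_sub_tsum_rpow hq)
          fun s => sub_le_sub_left (s.tsum_rpow_add_one_le hq) 1

/-- Split at `1 - s₁ < δ`: there `s₁ ^ q ≤ 1`, and elsewhere `s₁ ≤ 1 - δ ≤ exp (-δ)`. -/
lemma integral_rpow_le (hq : 0 ≤ q) (δ : ℝ) :
    ∫ s : MassPartition, s.1 0 ^ q ∂ν ≤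
      ν.real {s | 1 - s.1 0 < δ} + ν.real Set.univ * Real.exp (-(δ * q)) := by
  have hmeas : MeasurableSet {s : MassPartition | 1 - s.1 0 < δ} :=
    measurableSet_lt (measurable_const.sub (MassPartition.measurable_coord 0)) measurable_const
  have hind : Integrable ({s : MassPartition | 1 - s.1 0 < δ}.indicator fun _ => (1 : ℝ)) ν :=
    (integrable_const _).indicator hmeas
  calc ∫ s : MassPartition, s.1 0 ^ q ∂ν
      ≤ ∫ s, ({s : MassPartition | 1 - s.1 0 < δ}.indicator (fun _ => (1 : ℝ)) s
          + Real.exp (-(δ * q))) ∂ν := by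
        refine integral_mono (integrable_rpow hq) (hind.add (integrable_const _)) fun s => ?_
        by_cases hs : 1 - s.1 0 < δ
        · have := s.rpow_le_one hq
          simp only [Set.indicator, Set.mem_ofPred_eq, hs, if_true]
          linarith [Real.exp_pos (-(δ * q))]
        · simp only [Set.indicator, Set.mem_ofPred_eq, hs, if_false, zero_add]
          have h₁ : s.1 0 ≤ Real.exp (-δ) := by
            linarith [Real.add_one_le_exp (-δ), not_lt.1 hs]
          calc s.1 0 ^ q ≤ Real.exp (-δ) ^ q := Real.rpow_le_rpow (s.2.2.1 0) h₁ hq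
            _ = Real.exp (-(δ * q)) := by rw [← Real.exp_mul]; ring_nf
    _ = ν.real {s | 1 - s.1 0 < δ} + ν.real Set.univ * Real.exp (-(δ * q)) := by
        rw [integral_add hind (integrable_const _), integral_indicator_const _ hmeas]
        simp

/-- Polynomial erosion makes the Laplace exponent approach the total mass polynomially fast. -/
lemma HasPolynomialErosion.exists_sub_rpow_le_laplaceExponent (h : HasPolynomialErosion ν) :
    ∃ K γ : ℝ, 0 < K ∧ 0 < γ ∧ ν.real Set.univ ≤ K ∧
      ∀ q, 1 ≤ q → ν.real Set.univ - K * q ^ (-γ) ≤ laplaceExponent ν q := by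
  obtain ⟨C, c, hC, hc, h⟩ := h
  -- The cut `δ = q ^ (-1/2)` gives the errors `C q ^ (-c/2)` and `λ exp (-q ^ (1/2)) ≤ λ q ^
  -- (-1/2)`; `γ` is the worse exponent.
  refine ⟨C + ν.real Set.univ, min c 1 / 2, by positivity, by positivity, by linarith,
    fun q hq => ?_⟩
  have hq0 : 0 < q := by linarith
  set γ := min c 1 / 2 with hγ
  have hδ : q ^ (-(1 / 2) : ℝ) ≤ 1 := Real.rpow_le_one_of_one_le_of_nonpos hq (by norm_num)
  have hδ0 : 0 ≤ q ^ (-(1 / 2) : ℝ) := by positivity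
  have h₁ : ν.real {s | 1 - s.1 0 < q ^ (-(1 / 2) : ℝ)} ≤ C * q ^ (-γ) := by
    calc ν.real {s | 1 - s.1 0 < q ^ (-(1 / 2) : ℝ)}
        ≤ C * (q ^ (-(1 / 2) : ℝ)) ^ c :=
          ENNReal.toReal_le_of_le_ofReal (by positivity) (h _ hδ0 hδ)
      _ = C * q ^ (-(1 / 2) * c) := by rw [← Real.rpow_mul hq0.le]
      _ ≤ C * q ^ (-γ) := by
          gcongr
          linarith [min_le_left c 1]
  have h₂ : Real.exp (-(q ^ (-(1 / 2) : ℝ) * q)) ≤ q ^ (-γ) := by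
    have e : q ^ (-(1 / 2) : ℝ) * q = q ^ (1 / 2 : ℝ) := by
      rw [← Real.rpow_add_one hq0.ne']; norm_num
    have hp : 0 < q ^ (1 / 2 : ℝ) := by positivity
    calc Real.exp (-(q ^ (-(1 / 2) : ℝ) * q)) = (Real.exp (q ^ (1 / 2 : ℝ)))⁻¹ := by
          rw [e, Real.exp_neg]
      _ ≤ (q ^ (1 / 2 : ℝ))⁻¹ := by
          gcongr
          linarith [Real.add_one_le_exp (q ^ (1 / 2 : ℝ))]
      _ = q ^ (-(1 / 2) : ℝ) := (Real.rpow_neg hq0.le _).symm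
      _ ≤ q ^ (-γ) := by
          gcongr
          linarith [min_le_right c 1]
  have h₃ := integral_rpow_le (ν := ν) hq0.le (q ^ (-(1 / 2) : ℝ))
  have h₄ := sub_integral_rpow_le_laplaceExponent (ν := ν) hq0.le
  have h₅ := mul_le_mul_of_nonneg_left h₂ (measureReal_nonneg (μ := ν) (s := Set.univ))
  rw [add_mul]
  linarith

end LaplaceExponent

/-! ### Laplace transform of a Lévy process at all times, and tail bounds. -/

section LevyProcess

variable {Ω : Type*} [MeasurableSpace Ω] {P : Measure Ω} {ξ : ℝ≥0 → Ω → ℝ}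

/-- The Laplace transform `𝔼[exp (-q ξₜ)]`, with values in `[0, ∞]`. -/
noncomputable def laplaceTransform (P : Measure Ω) (ξ : ℝ≥0 → Ω → ℝ) (q : ℝ) (t : ℝ≥0) : ℝ≥0∞ :=
  ∫⁻ ω, ENNReal.ofReal (Real.exp (-q * ξ t ω)) ∂P

lemma measurable_ofReal_exp (q : ℝ) :
    Measurable fun x : ℝ => ENNReal.ofReal (Real.exp (-q * x)) := by
  fun_prop

namespace IsLevyProcess

/-- With values in `[0, ∞]`, multiplicativity needs no integrability, which is assumed only at time
`1`. -/
lemma laplaceTransform_add (h : IsLevyProcess P ξ) (q : ℝ) (s t : ℝ≥0) :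
    laplaceTransform P ξ q (s + t) = laplaceTransform P ξ q s * laplaceTransform P ξ q t := by
  have hm := measurable_ofReal_exp q
  have hind := (h.indep_increments.indepFun_eval_sub zero_le
    (le_self_add (a := s) (b := t)) h.zero).comp
    hm hm
  have hst : laplaceTransform P ξ q t
      = ∫⁻ ω, ENNReal.ofReal (Real.exp (-q * (ξ (s + t) ω - ξ s ω))) ∂P :=
    ((h.stationary_increments s t).comp hm).lintegral_eq.symm
  rw [hst, laplaceTransform, laplaceTransform]
  refine Eq.trans ?_ (lintegral_mul_eq_lintegral_mul_lintegral_of_indepFun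
    (hm.comp (h.measurable s)) (hm.comp ((h.measurable (s + t)).sub (h.measurable s))) hind)
  refine lintegral_congr fun ω => ?_
  rw [Pi.mul_apply]
  rw [← ENNReal.ofReal_mul (Real.exp_pos _).le, ← Real.exp_add]
  ring_nf

lemma laplaceTransform_zero [IsProbabilityMeasure P] (h : IsLevyProcess P ξ) (q : ℝ) :
    laplaceTransform P ξ q 0 = 1 := by
  have : (fun ω => ENNReal.ofReal (Real.exp (-q * ξ 0 ω))) =ᵐ[P] fun _ => 1 := by
    filter_upwards [h.zero] with ω hω
    simp [hω]
  rw [laplaceTransform, lintegral_congr_ae this]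
  simp

lemma laplaceTransform_nsmul [IsProbabilityMeasure P] (h : IsLevyProcess P ξ) (q : ℝ) (n : ℕ)
    (t : ℝ≥0) : laplaceTransform P ξ q (n * t) = laplaceTransform P ξ q t ^ n := by
  induction n with
  | zero => simp [h.laplaceTransform_zero]
  | succ n ih =>
    rw [pow_succ, ← ih, ← h.laplaceTransform_add]
    push_cast
    ring_nf

end IsLevyProcess

variable {Φ : ℝ → ℝ} {q : ℝ}

lemma HasLaplaceExponent.laplaceTransform_one (h : HasLaplaceExponent P ξ Φ) (hq : 0 ≤ q) :
    laplaceTransform P ξ q 1 = ENNReal.ofReal (Real.exp (-Φ q)) := by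
  rw [← (h q hq).2, ofReal_integral_eq_lintegral_ofReal (h q hq).1
    (ae_of_all _ fun _ => (Real.exp_pos _).le)]
  rfl

namespace IsLevyProcess

variable [IsProbabilityMeasure P]

lemma laplaceTransform_natCast (h : IsLevyProcess P ξ) (hΦ : HasLaplaceExponent P ξ Φ)
    (hq : 0 ≤ q) (n : ℕ) :
    laplaceTransform P ξ q n = ENNReal.ofReal (Real.exp (-Φ q * n)) := by
  have := h.laplaceTransform_nsmul q n 1
  rw [mul_one, hΦ.laplaceTransform_one hq, ← ENNReal.ofReal_pow (Real.exp_pos _).le,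
    ← Real.exp_nat_mul] at this
  rw [this, mul_comm]

lemma laplaceTransform_div (h : IsLevyProcess P ξ) (hΦ : HasLaplaceExponent P ξ Φ)
    (hq : 0 ≤ q) (k : ℕ) {n : ℕ} (hn : n ≠ 0) :
    laplaceTransform P ξ q (k / n) = ENNReal.ofReal (Real.exp (-Φ q * (k / n))) := by
  have hn' : (n : ℝ) ≠ 0 := Nat.cast_ne_zero.2 hn
  refine (ENNReal.pow_right_strictMono hn).injective ?_
  rw [← h.laplaceTransform_nsmul, mul_div_cancel₀ _ (Nat.cast_ne_zero.2 hn),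
    h.laplaceTransform_natCast hΦ hq, ← ENNReal.ofReal_pow (Real.exp_pos _).le,
    ← Real.exp_nat_mul]
  congr 2
  field_simp

/-- Fatou along rational times approaching `t` from the right, where the paths are continuous. -/
lemma laplaceTransform_le (h : IsLevyProcess P ξ) (hΦ : HasLaplaceExponent P ξ Φ)
    (hq : 0 ≤ q) (t : ℝ≥0) :
    laplaceTransform P ξ q t ≤ ENNReal.ofReal (Real.exp (-Φ q * t)) := by
  let u : ℕ → ℝ≥0 := fun n => ⌈(t : ℝ) * n⌉₊ / n
  have hu : Tendsto (fun n => (u n : ℝ)) atTop (𝓝 t) := by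
    simpa [u, Function.comp_def] using
      (tendsto_nat_ceil_mul_div_atTop t.coe_nonneg).comp (tendsto_natCast_atTop_atTop (R := ℝ))
  have hu' : Tendsto u atTop (𝓝[≥] t) := by
    refine tendsto_nhdsWithin_iff.2 ⟨NNReal.tendsto_coe.1 hu, ?_⟩
    filter_upwards [eventually_gt_atTop 0] with n hn
    have hn' : (0 : ℝ) < n := Nat.cast_pos.2 hn
    rw [Set.mem_Ici, ← NNReal.coe_le_coe]
    simpa [u, le_div_iff₀ hn'] using Nat.le_ceil ((t : ℝ) * n)
  have hlim : ∀ᵐ ω ∂P, liminf (fun n => ENNReal.ofReal (Real.exp (-q * ξ (u n) ω))) atTop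
      = ENNReal.ofReal (Real.exp (-q * ξ t ω)) := by
    filter_upwards [h.cadlag] with ω hω
    refine Tendsto.liminf_eq (ENNReal.tendsto_ofReal ?_)
    exact (Real.continuous_exp.tendsto _).comp (((hω t).1.tendsto.comp hu').const_mul _)
  rw [laplaceTransform, ← lintegral_congr_ae hlim]
  refine (lintegral_liminf_le fun n => (measurable_ofReal_exp q).comp (h.measurable _)).trans_eq ?_
  refine Tendsto.liminf_eq ?_
  have : Tendsto (fun n => ENNReal.ofReal (Real.exp (-Φ q * u n))) atTop
      (𝓝 (ENNReal.ofReal (Real.exp (-Φ q * t)))) :=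
    ENNReal.tendsto_ofReal ((Real.continuous_exp.tendsto _).comp (hu.const_mul _))
  refine this.congr' ?_
  filter_upwards [eventually_gt_atTop 0] with n hn
  have := h.laplaceTransform_div hΦ hq ⌈(t : ℝ) * n⌉₊ hn.ne'
  rw [show ((u n : ℝ≥0) : ℝ) = (⌈(t : ℝ) * n⌉₊ : ℝ) / n by simp [u], ← this]
  rfl

lemma laplaceTransform_eq (h : IsLevyProcess P ξ) (hΦ : HasLaplaceExponent P ξ Φ)
    (hq : 0 ≤ q) (t : ℝ≥0) :
    laplaceTransform P ξ q t = ENNReal.ofReal (Real.exp (-Φ q * t)) := by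
  refine le_antisymm (h.laplaceTransform_le hΦ hq t) ?_
  -- The transform is known at the integer `n` and factors over `t` and `n - t`, so the upper bound
  -- at `n - t` forces the lower bound at `t`.
  obtain ⟨n, hn⟩ := exists_nat_ge t
  have key := h.laplaceTransform_add q t (n - t)
  rw [add_tsub_cancel_of_le hn, h.laplaceTransform_natCast hΦ hq] at key
  have hs := h.laplaceTransform_le hΦ hq (n - t)
  have hpos : 0 < Real.exp (-Φ q * ((n - t : ℝ≥0) : ℝ)) := Real.exp_pos _
  refine (ENNReal.mul_le_mul_iff_left (c := ENNReal.ofReal (Real.exp (-Φ q * ((n - t : ℝ≥0) : ℝ))))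
    (ENNReal.ofReal_pos.2 hpos).ne' ENNReal.ofReal_ne_top).1 ?_
  rw [← ENNReal.ofReal_mul (Real.exp_pos _).le, ← Real.exp_add, ← mul_add, ← NNReal.coe_add,
    add_tsub_cancel_of_le hn, NNReal.coe_natCast, key]
  gcongr

lemma integrable_exp (h : IsLevyProcess P ξ) (hΦ : HasLaplaceExponent P ξ Φ)
    (hq : 0 ≤ q) (t : ℝ≥0) : Integrable (fun ω => Real.exp (-q * ξ t ω)) P := by
  refine ⟨(Real.measurable_exp.comp ((h.measurable t).const_mul _)).aestronglyMeasurable, ?_⟩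
  rw [hasFiniteIntegral_iff_ofReal (ae_of_all _ fun _ => (Real.exp_pos _).le)]
  exact (h.laplaceTransform_eq hΦ hq t).trans_lt ENNReal.ofReal_lt_top

lemma integral_exp (h : IsLevyProcess P ξ) (hΦ : HasLaplaceExponent P ξ Φ)
    (hq : 0 ≤ q) (t : ℝ≥0) : ∫ ω, Real.exp (-q * ξ t ω) ∂P = Real.exp (-Φ q * t) := by
  rw [integral_eq_lintegral_of_nonneg_ae (ae_of_all _ fun _ => (Real.exp_pos _).le)
    (h.integrable_exp hΦ hq t).1]
  exact (congrArg ENNReal.toReal (h.laplaceTransform_eq hΦ hq t)).trans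
    (ENNReal.toReal_ofReal (Real.exp_pos _).le)

lemma measureReal_le (h : IsLevyProcess P ξ) (hΦ : HasLaplaceExponent P ξ Φ)
    (hq : 0 ≤ q) (t : ℝ≥0) (w : ℝ) :
    P.real {ω | ξ t ω ≤ w} ≤ Real.exp (q * w - Φ q * t) := by
  have := measure_le_le_exp_mul_mgf (μ := P) (X := ξ t) (t := -q) w (by linarith)
    (h.integrable_exp hΦ hq t)
  rw [mgf, h.integral_exp hΦ hq t, ← Real.exp_add] at this
  refine this.trans_eq ?_
  ring_nf

/-- Chernoff at a negative level, with `q → ∞`. -/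
lemma ae_nonneg (h : IsLevyProcess P ξ) (hΦ : HasLaplaceExponent P ξ Φ)
    (hΦ0 : ∀ q, 0 ≤ q → 0 ≤ Φ q) (t : ℝ≥0) : ∀ᵐ ω ∂P, 0 ≤ ξ t ω := by
  have key : ∀ n : ℕ, ∀ᵐ ω ∂P, ¬ ξ t ω ≤ -(1 / ((n : ℝ) + 1)) := by
    intro n
    have hn : (0 : ℝ) < 1 / ((n : ℝ) + 1) := by positivity
    have hlim : Tendsto (fun q : ℝ => Real.exp (q * -(1 / ((n : ℝ) + 1)))) atTop (𝓝 0) :=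
      Real.tendsto_exp_atBot.comp (tendsto_id.atTop_mul_const_of_neg (by linarith))
    have hle : P.real {ω | ξ t ω ≤ -(1 / ((n : ℝ) + 1))} ≤ 0 := by
      refine ge_of_tendsto hlim ?_
      filter_upwards [eventually_ge_atTop 0] with q hq
      refine (h.measureReal_le hΦ hq t _).trans (Real.exp_le_exp.2 ?_)
      linarith [mul_nonneg (hΦ0 q hq) t.coe_nonneg]
    rw [ae_iff]
    simpa using (measureReal_eq_zero_iff).1 (le_antisymm hle measureReal_nonneg)
  filter_upwards [ae_all_iff.2 key] with ω hω
  by_contra! hneg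
  obtain ⟨n, hn⟩ := exists_nat_one_div_lt (neg_pos.2 hneg)
  exact hω n (by linarith)

/-- As `q → ∞`, `exp (-q ξₜ)` tends a.s. to the indicator of `ξₜ ≤ 0`, dominated by `1`. -/
lemma exp_le_measureReal (h : IsLevyProcess P ξ) (hΦ : HasLaplaceExponent P ξ Φ)
    (hΦ0 : ∀ q, 0 ≤ q → 0 ≤ Φ q) {b : ℝ} (hb : ∀ q, 0 ≤ q → Φ q ≤ b) (t : ℝ≥0) :
    Real.exp (-b * t) ≤ P.real {ω | ξ t ω ≤ 0} := by
  have hnn := h.ae_nonneg hΦ hΦ0 t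
  have hmeas : MeasurableSet {ω | ξ t ω ≤ 0} := measurableSet_le (h.measurable t) measurable_const
  have hlim : Tendsto (fun q : ℝ => ∫ ω, Real.exp (-q * ξ t ω) ∂P) atTop
      (𝓝 (∫ ω, {ω | ξ t ω ≤ 0}.indicator (fun _ => (1 : ℝ)) ω ∂P)) := by
    refine tendsto_integral_filter_of_dominated_convergence (fun _ => 1)
      (Eventually.of_forall fun q =>
        (Real.measurable_exp.comp ((h.measurable t).const_mul _)).aestronglyMeasurable) ?_
      (integrable_const _) ?_
    · filter_upwards [eventually_ge_atTop 0] with q hq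
      filter_upwards [hnn] with ω hω
      rw [Real.norm_of_nonneg (Real.exp_pos _).le, Real.exp_le_one_iff]
      linarith [mul_nonneg hq hω]
    · filter_upwards [hnn] with ω hω
      rcases hω.eq_or_lt with h0 | hpos
      · simp [← h0]
      · simp only [Set.indicator, Set.mem_ofPred_eq, not_le.2 hpos, if_false]
        exact Real.tendsto_exp_atBot.comp
          (tendsto_neg_atTop_atBot.atBot_mul_const hpos)
  rw [integral_indicator_const _ hmeas, smul_eq_mul, mul_one] at hlim
  refine ge_of_tendsto hlim ?_
  filter_upwards [eventually_ge_atTop 0] with q hq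
  rw [h.integral_exp hΦ hq t, Real.exp_le_exp]
  have := mul_le_mul_of_nonneg_right (hb q hq) t.coe_nonneg
  linarith

end IsLevyProcess

end LevyProcess

/-! ### Optimised Chernoff bound and conclusion. -/

/-- Optimising `q ↦ q w + t K q ^ (-γ)` over `q ≥ 1`. -/
lemma exists_mul_add_mul_rpow_le {K γ t w : ℝ} (hγ : 0 < γ) (hw : 0 < w)
    (hwt : w ≤ t) :
    ∃ q : ℝ, 1 ≤ q ∧ q * w + K * q ^ (-γ) * t
      = (1 + K) * t ^ (1 / (1 + γ)) * w ^ (1 - 1 / (1 + γ)) := by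
  have ht : 0 < t := hw.trans_le hwt
  have hβ : 0 < 1 / (1 + γ) := by positivity
  -- This `q` solves `q w = t q ^ (-γ)`; it is at least `1` because `w ≤ t`.
  refine ⟨(t / w) ^ (1 / (1 + γ)), Real.one_le_rpow ((one_le_div hw).2 hwt) hβ.le, ?_⟩
  have h₁ : (t / w) ^ (1 / (1 + γ)) * w = t ^ (1 / (1 + γ)) * w ^ (1 - 1 / (1 + γ)) := by
    rw [Real.div_rpow ht.le hw.le, Real.rpow_sub hw, Real.rpow_one]
    ring
  have h₂ : ((t / w) ^ (1 / (1 + γ))) ^ (-γ) * t = t ^ (1 / (1 + γ)) * w ^ (1 - 1 / (1 + γ)) := by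
    have e : 1 / (1 + γ) * -γ = 1 / (1 + γ) - 1 := by field_simp; ring
    rw [← Real.rpow_mul (by positivity), e, Real.div_rpow ht.le hw.le, Real.rpow_sub ht,
      Real.rpow_one, ← neg_sub (1 : ℝ), Real.rpow_neg hw.le]
    field_simp
  rw [h₁, mul_assoc K, h₂]
  ring

lemma IsLevyProcess.log_measureReal_add_le {Ω : Type*} [MeasurableSpace Ω] {P : Measure Ω}
    [IsProbabilityMeasure P] {ξ : ℝ≥0 → Ω → ℝ} {Φ : ℝ → ℝ} (h : IsLevyProcess P ξ)
    (hΦ : HasLaplaceExponent P ξ Φ) {K γ b : ℝ} (hK : 0 < K) (hγ : 0 < γ) (hbK : b ≤ K)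
    (hlow : ∀ q, 1 ≤ q → b - K * q ^ (-γ) ≤ Φ q) (t : ℝ≥0) {w : ℝ} (hw : 0 ≤ w)
    (hpos : 0 < P.real {ω | ξ t ω ≤ w}) :
    Real.log (P.real {ω | ξ t ω ≤ w}) + b * t
      ≤ (1 + K) * (t : ℝ) ^ (1 / (1 + γ)) * w ^ (1 - 1 / (1 + γ)) := by
  have chernoff : ∀ q, 1 ≤ q →
      Real.log (P.real {ω | ξ t ω ≤ w}) + b * t ≤ q * w + K * q ^ (-γ) * t := by
    intro q hq
    have h₁ := (Real.log_le_iff_le_exp hpos).2 (h.measureReal_le hΦ (by linarith : 0 ≤ q) t w)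
    have h₂ := mul_le_mul_of_nonneg_right (hlow q hq) t.coe_nonneg
    rw [sub_mul] at h₂
    linarith
  have hβ : 0 < 1 - 1 / (1 + γ) := by
    rw [sub_pos, div_lt_one (by positivity)]
    linarith
  rcases hw.eq_or_lt with rfl | hw
  -- At `w = 0` there is no finite optimiser: `q → ∞` instead.
  · rw [Real.zero_rpow hβ.ne', mul_zero]
    have hlim : Tendsto (fun q : ℝ => K * q ^ (-γ) * t) atTop (𝓝 (K * 0 * t)) :=
      ((tendsto_rpow_neg_atTop hγ).const_mul K).mul_const _
    rw [mul_zero, zero_mul] at hlim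
    refine ge_of_tendsto hlim ?_
    filter_upwards [eventually_ge_atTop 1] with q hq
    simpa using chernoff q hq
  · rcases le_total w t with hwt | htw
    · obtain ⟨q, hq, e⟩ := exists_mul_add_mul_rpow_le (K := K) hγ hw hwt
      exact e ▸ chernoff q hq
    -- For `t ≤ w` the optimiser may drop below `1`, but the trivial bound `P ≤ 1` suffices, since
    -- `b ≤ K` and `t ≤ t ^ β w ^ (1 - β)`.
    · have h₁ : Real.log (P.real {ω | ξ t ω ≤ w}) ≤ 0 :=
        Real.log_nonpos measureReal_nonneg measureReal_le_one
      have h₂ : (t : ℝ) ≤ (t : ℝ) ^ (1 / (1 + γ)) * w ^ (1 - 1 / (1 + γ)) := by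
        calc (t : ℝ) = (t : ℝ) ^ (1 / (1 + γ)) * (t : ℝ) ^ (1 - 1 / (1 + γ)) := by
              rw [← Real.rpow_add' t.coe_nonneg (by norm_num)]; norm_num
          _ ≤ _ := by gcongr
      calc _ ≤ K * (t : ℝ) := by
            linarith [mul_le_mul_of_nonneg_right hbK t.2, show b * (t : ℝ) ≤ K * t by gcongr]
        _ ≤ (1 + K) * t := by gcongr; linarith
        _ ≤ (1 + K) * ((t : ℝ) ^ (1 / (1 + γ)) * w ^ (1 - 1 / (1 + γ))) := by gcongr
        _ = _ := by ring

end Fragmentation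

theorem theorem3p1 (ν : MeasureTheory.Measure Fragmentation.MassPartition)
    [MeasureTheory.IsFiniteMeasure ν]
    (hν : Fragmentation.IsDislocationMeasure ν)
    (hreg : Fragmentation.HasPolynomialErosion ν) :
    ∃ β C : ℝ, 0 < β ∧ β < 1 ∧ 0 < C ∧
      ∀ (Ω : Type*) [MeasurableSpace Ω] (P : MeasureTheory.Measure Ω)
        [MeasureTheory.IsProbabilityMeasure P] (ξ : ℝ≥0 → Ω → ℝ),
        Fragmentation.IsLevyProcess P ξ →
        Fragmentation.HasLaplaceExponent P ξ (Fragmentation.laplaceExponent ν) →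
        ∀ (t : ℝ≥0) (w : ℝ), 0 ≤ w → w ≤ 1 →
          ∃ e : ℝ, |e| ≤ C * (t : ℝ) ^ β * w ^ (1 - β) ∧
            P.real {ω | ξ t ω ≤ w} = Real.exp (-(ν.real Set.univ) * t + e) := by
  obtain ⟨K, γ, hK, hγ, hνK, hlow⟩ := hreg.exists_sub_rpow_le_laplaceExponent
  refine ⟨1 / (1 + γ), 1 + K, by positivity, ?_, by positivity, ?_⟩
  · rw [div_lt_one (by positivity)]
    linarith
  intro Ω _ P _ ξ hξ hΦ t w hw _
  have hexp : Real.exp (-(ν.real Set.univ) * t) ≤ P.real {ω | ξ t ω ≤ w} :=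
    (hξ.exp_le_measureReal hΦ (fun _ => Fragmentation.laplaceExponent_nonneg)
      (fun _ => Fragmentation.laplaceExponent_le) t).trans
      (measureReal_mono fun ω (hω : ξ t ω ≤ 0) => hω.trans hw)
  have hpos : 0 < P.real {ω | ξ t ω ≤ w} := (Real.exp_pos _).trans_le hexp
  refine ⟨Real.log (P.real {ω | ξ t ω ≤ w}) + ν.real Set.univ * t, ?_, ?_⟩
  · rw [abs_of_nonneg]
    · exact hξ.log_measureReal_add_le hΦ hK hγ hνK hlow t hw hpos
    · linarith [(Real.le_log_iff_exp_le hpos).2 hexp]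
  · rw [show -(ν.real Set.univ) * (t : ℝ) + (Real.log (P.real {ω | ξ t ω ≤ w})
      + ν.real Set.univ * t) = Real.log (P.real {ω | ξ t ω ≤ w}) by ring, Real.exp_log hpos]
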